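/- Let $V$ be either a finite set with $n$ elements (the case $q=1$) or an $n$-dimensional vector space over a finite field $\mathbb{F}_q$ (the case $q\ge 2$). In the first case a subspace of $V$ means a subset and $\operatorname{rk}$ denotes cardinality; in the second case subspaces are linear subspaces and $\operatorname{rk}$ denotes dimension. Put $\operatorname{cork}U=n-\operatorname{rk}U$. For $0\le k\le n$, let $\left[{V\atop k}\right]$ be the set of all subspaces of rank $k$. For $0\le t\le\min(k,n-k)$, let $\bar V^{(k)}_t\subseteq\mathbb{R}^{\left[{V\atop k}\right]}$ be the row space of the incidence matrix $W^{(tk)}$ whose rows are indexed by the $T\in\left[{V\atop t}\right]$ and whose columns are indexed by the $K\in\left[{V\atop k}\right]$, with entry $1$ if $T\le K$ and $0$ otherwise. The degree $\deg f$ of a non-zero function $f:\left[{V\atop k}\right]\to\mathbb{R}$ is the smallest $t\in\{0,\dots,\min(k,n-k)\}$ with $f\in\bar V^{(k)}_t$, and $\deg 0=-\infty$. The degree of a set $\mathcal F\subseteq\left[{V\atop k}\right]$ is the degree of its characteristic function. Theorem. Let $k\in\{0,\dots,n\}$. (a) Let $I\le J\le V$ be subspaces, $i=\operatorname{rk}I$,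 $j=\operatorname{cork}J$. The basic set $\mathcal F^{(V,k)}(I,J)=\{K\in\left[{V\atop k}\right] : I\le K\le J\}$ has degree $$\deg\mathcal F^{(V,k)}(I,J)=\begin{cases}-\infty&\text{if } i>k\text{ or }j>n-k,\\ \min(i+j,\,k,\,n-k)&\text{otherwise.}\end{cases}$$ (b) In particular, for every subspace $I\le V$ with $i=\operatorname{rk}I$, the characteristic function $\boldsymbol{x}^{(k)}_I$ of the pencil $\{K\in\left[{V\atop k}\right] : I\le K\}$ has degree $-\infty$ if $i>k$, and $\min(i,\,n-k)$ if $i\le k$. (c) For every subspace $J\le V$ with $j=\operatorname{cork}J$, the characteristic function $\bar{\boldsymbol{x}}^{(k)}_J$ of the dual pencil $\{K\in\left[{V\atop k}\right] : K\le J\}$ has degree $-\infty$ if $j>n-k$, and $\min(j,\,k)$ if $j\le n-k$. -/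

import Mathlib

noncomputable section

namespace CameronLiebler

/-! In the following, `L` is the lattice of subspaces of the ambient space (all subsets of a finite
set, or all linear subspaces of a finite vector space) and `rk : L → ℕ` is its rank function
(cardinality, or dimension). The rank of the ambient space is `rk ⊤`. -/

/-- The set of all subspaces of rank `k`. -/
abbrev Sub {L : Type*} (rk : L → ℕ) (k : ℕ) : Type _ := {U : L // rk U = k}

/-- The corank `n - rk U`, where `n = rk ⊤`. -/
def cork {L : Type*} [LE L] [OrderTop L] (rk : L → ℕ) (U : L) : ℕ := rk ⊤ - rk U

open Classical in
/-- The `t`-vs.-`k` incidence matrix: its `(T, K)` entry is `1` if `T ≤ K`, and `0` otherwise. -/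
def incidence {L : Type*} [LE L] (rk : L → ℕ) (t k : ℕ) : Matrix (Sub rk t) (Sub rk k) ℝ :=
  Matrix.of fun T K => if T.1 ≤ K.1 then 1 else 0

/-- The row space of the `t`-vs.-`k` incidence matrix. -/
def rowSpace {L : Type*} [LE L] (rk : L → ℕ) (t k : ℕ) : Submodule ℝ (Sub rk k → ℝ) :=
  Submodule.span ℝ (Set.range (incidence rk t k).row)

open Classical in
/-- The degree of a real function on the `k`-subspaces: `-∞` (that is, `⊥`) for the zero function,
otherwise the smallest `t ∈ {0, …, min(k, n - k)}` such that the function lies in the row space of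
the `t`-vs.-`k` incidence matrix. (If there were no such `t`, the value would be `⊤`, so an equality
of the degree with a natural number includes the existence of such a `t`.) -/
def deg {L : Type*} [LE L] [OrderTop L] (rk : L → ℕ) {k : ℕ} (f : Sub rk k → ℝ) : WithBot ℕ∞ :=
  if f = 0 then ⊥
  else ((⨅ (t : ℕ) (_ : t ≤ min k (rk ⊤ - k) ∧ f ∈ rowSpace rk t k), (t : ℕ∞) : ℕ∞) : WithBot ℕ∞)

/-- The characteristic function of a set of `k`-subspaces. -/
def charFun {L : Type*} {rk : L → ℕ} {k : ℕ} (S : Set (Sub rk k)) : Sub rk k → ℝ :=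
  S.indicator 1

/-- The degree of a set of `k`-subspaces is the degree of its characteristic function. -/
def degSet {L : Type*} [LE L] [OrderTop L] (rk : L → ℕ) {k : ℕ} (S : Set (Sub rk k)) :
    WithBot ℕ∞ :=
  deg rk (charFun S)

/-- The basic set of all `k`-subspaces in the interval between `I` and `J`. -/
def basicSet {L : Type*} [LE L] (rk : L → ℕ) (k : ℕ) (I J : L) : Set (Sub rk k) :=
  {K | I ≤ K.1 ∧ K.1 ≤ J}

/-- The characteristic function of the pencil of all `k`-subspaces containing `I`. -/
def pencil {L : Type*} [LE L] (rk : L → ℕ) (k : ℕ) (I : L) : Sub rk k → ℝ :=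
  charFun {K | I ≤ K.1}

/-- The characteristic function of the dual pencil of all `k`-subspaces contained in `J`. -/
def dualPencil {L : Type*} [LE L] (rk : L → ℕ) (k : ℕ) (J : L) : Sub rk k → ℝ :=
  charFun {K | K.1 ≤ J}

/-- The rank function of the lattice of subsets of a finite set. -/
def setRk (V : Type*) (U : Finset V) : ℕ := U.card

/-- The rank function of the lattice of linear subspaces of a vector space. -/
def linRk (F V : Type*) [Field F] [AddCommGroup V] [Module F V] (U : Submodule F V) : ℕ :=
  Module.finrank F U

end CameronLiebler

end

open CameronLiebler

/-! Put `t = min (i + j, k, n - k)`. Both cases share one upper bound, carried out in a finite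
modular lattice where the number of covers of `I` below `U` depends only on ranks and strictly
increases with the rank of `U`.

Upper bound (`charFun_basicSet_mem_rowSpace`, `rowSpace_min_eq_top`): let `J'` cover `J`. For `K` in
`[I, J']`, the number of covers of `I` below `J ⊓ K` takes one value if `K ≤ J` and a smaller one
otherwise. Hence the basic set of `I, J` is a linear combination of basic sets with upper end `J'`,
and induction on the corank reaches pencils of rank `i + j`. Single points are themselves basic
sets, so the row space at `min (k, n - k)` is everything.

Lower bound (`HasDegreeWitnesses`): a linear functional kills all pencils of rank below `t` but not
the basic set. Fix `K` in `[I, J]`. For sets it is an alternating sum over exchanges of `t` elements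
of `K` with `t` elements outside. For vector spaces it is a sum over graphs of maps `A` from `K` to
a complement `C`, weighted by a function of `trace (B ∘ₗ A)` with `B` of rank `t`. -/

namespace CameronLiebler

/-- The properties of a rank function on a finite modular lattice used to compute degrees of basic
sets. The number of covers of `I` below `U` depends only on the ranks of `I` and `U`. -/
structure IsRankFunction {L : Type*} [Lattice L] [BoundedOrder L] [Finite L] (rk : L → ℕ) :
    Prop where
  bot : rk ⊥ = 0
  strictMono : StrictMono rk
  modular : ∀ a b, rk (a ⊔ b) + rk (a ⊓ b) = rk a + rk b
  covers : ∃ c : ℕ → ℕ → ℕ, (∀ i u, i ≤ u → c i u < c i (u + 1)) ∧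
    ∀ I U, I ≤ U → {T | I ≤ T ∧ T ≤ U ∧ rk T = rk I + 1}.ncard = c (rk I) (rk U)

theorem sum_ite_eq_ncard {α : Type*} [Fintype α] (p q : α → Prop) [DecidablePred p]
    [DecidablePred q] :
    ∑ T ∈ Finset.univ.filter p, (if q T then (1 : ℝ) else 0) = {T | p T ∧ q T}.ncard := by
  rw [Finset.sum_boole, Finset.filter_filter, ← Set.ncard_coe_finset]
  simp

/-! ### Row spaces and degrees in an ordered set. -/

section Preorder

variable {L : Type*} [Preorder L] {rk : L → ℕ} {k : ℕ}

open Classical in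
theorem pencil_apply (I : L) (K : Sub rk k) : pencil rk k I K = if I ≤ K.1 then 1 else 0 := by
  simp [pencil, charFun, Set.indicator_apply]

open Classical in
theorem charFun_basicSet_apply (I J : L) (K : Sub rk k) :
    charFun (basicSet rk k I J) K = if I ≤ K.1 ∧ K.1 ≤ J then 1 else 0 := by
  simp [basicSet, charFun, Set.indicator_apply]

theorem pencil_mem_rowSpace {t : ℕ} {T : L} (hT : rk T = t) : pencil rk k T ∈ rowSpace rk t k := by
  refine Submodule.subset_span ⟨⟨T, hT⟩, ?_⟩
  ext K
  rw [pencil_apply]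
  rfl

theorem rowSpace_le_iff {t : ℕ} {p : Submodule ℝ (Sub rk k → ℝ)} :
    rowSpace rk t k ≤ p ↔ ∀ T, rk T = t → pencil rk k T ∈ p := by
  refine ⟨fun h T hT => h (pencil_mem_rowSpace hT), fun h => ?_⟩
  rw [rowSpace, Submodule.span_le]
  rintro _ ⟨T, rfl⟩
  rw [SetLike.mem_coe]
  convert h T.1 T.2 using 1
  ext K
  rw [pencil_apply]
  rfl

theorem deg_eq_of_mem [OrderTop L] {f : Sub rk k → ℝ} {t : ℕ} (hf : f ≠ 0) (ht : t ≤ min k (rk (⊤ : L) - k))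
    (hmem : f ∈ rowSpace rk t k) (hmin : ∀ s < t, f ∉ rowSpace rk s k) :
    deg rk f = ((t : ℕ∞) : WithBot ℕ∞) := by
  rw [deg, if_neg hf]
  congr 1
  refine le_antisymm (iInf₂_le t ⟨ht, hmem⟩) (le_iInf₂ fun s hs => ?_)
  by_contra hlt
  exact hmin s (by simpa using hlt) hs.2

end Preorder

/-! ### The degree formula in a modular lattice, given witnesses. -/

section Lattice

variable {L : Type*} [Lattice L] [BoundedOrder L] {rk : L → ℕ} {k : ℕ}

theorem pencil_eq (I : L) : pencil rk k I = charFun (basicSet rk k I ⊤) := by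
  simp [pencil, basicSet]

theorem dualPencil_eq (J : L) : dualPencil rk k J = charFun (basicSet rk k ⊥ J) := by
  simp [dualPencil, basicSet]

variable [Finite L]

namespace IsRankFunction

theorem exists_between (h : IsRankFunction rk) {I J : L} (hIJ : I ≤ J) {m : ℕ} (hI : rk I ≤ m)
    (hJ : m ≤ rk J) : ∃ K, I ≤ K ∧ K ≤ J ∧ rk K = m := by
  induction m, hI using Nat.le_induction with
  | base => exact ⟨I, le_rfl, hIJ, rfl⟩
  | succ m hm ih =>
    obtain ⟨K, hIK, hKJ, rfl⟩ := ih (by omega)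
    obtain ⟨c, hc, hcard⟩ := h.covers
    have hpos : 0 < c (rk K) (rk J) := by
      obtain ⟨u, hu⟩ : ∃ u, rk J = u + 1 := ⟨rk J - 1, by omega⟩
      have := hc (rk K) u (by omega)
      rw [hu]; omega
    rw [← hcard K J hKJ, Set.ncard_pos] at hpos
    obtain ⟨T, h1, h2, h3⟩ := hpos
    exact ⟨T, hIK.trans h1, h2, h3⟩

/-- The rank of `J ⊔ K` exceeds that of `J` and is at most that of `J'`, so it equals the latter;
the modular law then gives the rank of the meet. -/
theorem rank_inf_of_cover (h : IsRankFunction rk) {J J' K : L} (hJ : J ≤ J')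
    (hr : rk J' = rk J + 1) (hK : K ≤ J') (hKJ : ¬ K ≤ J) : rk (J ⊓ K) + 1 = rk K := by
  have h1 := h.modular J K
  have h2 : rk J < rk (J ⊔ K) := h.strictMono (left_lt_sup.2 hKJ)
  have h3 : rk (J ⊔ K) ≤ rk J' := h.strictMono.monotone (sup_le hJ hK)
  omega

/-- Double counting: the pencils of all covers of `S` add up to `c s k` times the pencil of `S`, and
`c s k` is nonzero because `s < k`. -/
theorem rowSpace_succ (h : IsRankFunction rk) {s : ℕ} (hs : s < k) :
    rowSpace rk s k ≤ rowSpace rk (s + 1) k := by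
  classical
  have := Fintype.ofFinite L
  obtain ⟨c, hc, hcard⟩ := h.covers
  rw [rowSpace_le_iff]
  rintro S rfl
  have hpos : (c (rk S) k : ℝ) ≠ 0 := by
    obtain ⟨u, rfl⟩ : ∃ u, k = u + 1 := ⟨k - 1, by omega⟩
    have := hc (rk S) u (by omega)
    exact_mod_cast (by omega : c (rk S) (u + 1) ≠ 0)
  have key : ∑ T ∈ Finset.univ.filter (fun T => S ≤ T ∧ rk T = rk S + 1), pencil rk k T
      = (c (rk S) k : ℝ) • pencil rk k S := by
    ext K
    simp only [Finset.sum_apply, Pi.smul_apply, pencil_apply, smul_eq_mul]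
    rw [sum_ite_eq_ncard]
    by_cases hSK : S ≤ K.1
    · have hK := hcard S K.1 hSK
      rw [K.2] at hK
      rw [if_pos hSK, mul_one, ← hK]
      congr 2
      ext T
      simp only [Set.mem_ofPred_eq]
      tauto
    · rw [if_neg hSK, mul_zero, Nat.cast_eq_zero, Set.ncard_eq_zero]
      ext T
      simp only [Set.mem_ofPred_eq, Set.mem_empty_iff_false, iff_false]
      exact fun hT => hSK (hT.1.1.trans hT.2)
  rw [← Submodule.smul_mem_iff _ hpos, ← key]
  refine Submodule.sum_mem _ fun T hT => pencil_mem_rowSpace ?_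
  exact (Finset.mem_filter.1 hT).2.2

theorem rowSpace_mono (h : IsRankFunction rk) {s t : ℕ} (hst : s ≤ t) (ht : t ≤ k) :
    rowSpace rk s k ≤ rowSpace rk t k := by
  induction t, hst using Nat.le_induction with
  | base => exact le_rfl
  | succ t _ ih => exact (ih (by omega)).trans (h.rowSpace_succ ht)

theorem charFun_basicSet_mem_rowSpace (h : IsRankFunction rk) {j : ℕ} :
    ∀ {I J : L}, I ≤ J → rk J + j = rk (⊤ : L) → rk I + j ≤ k →
      charFun (basicSet rk k I J) ∈ rowSpace rk (rk I + j) k := by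
  classical
  have := Fintype.ofFinite L
  obtain ⟨c, hc, hcard⟩ := h.covers
  induction j with
  | zero =>
    intro I J _ hJ _
    have : J = ⊤ := by
      by_contra hne
      have := h.strictMono (lt_top_iff_ne_top.2 hne)
      omega
    rw [this, ← pencil_eq]
    exact pencil_mem_rowSpace rfl
  | succ j ih =>
    intro I J hIJ hJ hk
    obtain ⟨J', hJJ', -, hJ'⟩ := h.exists_between (le_top : J ≤ ⊤) (m := rk J + 1)
      (by omega) (by omega)
    obtain ⟨u, rfl⟩ : ∃ u, k = u + 1 := ⟨k - 1, by omega⟩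
    have hlt := hc (rk I) u (by omega)
    have hne : ((c (rk I) (u + 1) : ℝ) - c (rk I) u) ≠ 0 := by
      rw [sub_ne_zero]
      exact_mod_cast hlt.ne'
    -- At `K` in `[I, J']` the sum counts covers of `I` below `J ⊓ K`, which has rank `u + 1` if `K
    -- ≤ J` and `u` otherwise. Subtracting `c (rk I) u` leaves a multiple of the indicator of `K ≤
    -- J`.
    have key : (∑ T ∈ Finset.univ.filter (fun T => I ≤ T ∧ T ≤ J ∧ rk T = rk I + 1),
          charFun (basicSet rk (u + 1) T J'))
        - (c (rk I) u : ℝ) • charFun (basicSet rk (u + 1) I J')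
        = ((c (rk I) (u + 1) : ℝ) - c (rk I) u) • charFun (basicSet rk (u + 1) I J) := by
      ext K
      simp only [Finset.sum_apply, Pi.smul_apply, Pi.sub_apply, charFun_basicSet_apply, smul_eq_mul]
      rw [sum_ite_eq_ncard]
      by_cases hK : I ≤ K.1 ∧ K.1 ≤ J'
      · have hset : {T | (I ≤ T ∧ T ≤ J ∧ rk T = rk I + 1) ∧ T ≤ K.1 ∧ K.1 ≤ J'}
            = {T | I ≤ T ∧ T ≤ J ⊓ K.1 ∧ rk T = rk I + 1} := by
          ext T
          simp only [Set.mem_ofPred_eq, le_inf_iff]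
          tauto
        rw [if_pos hK, hset, hcard I (J ⊓ K.1) (le_inf hIJ hK.1)]
        by_cases hKJ : K.1 ≤ J
        · rw [if_pos ⟨hK.1, hKJ⟩, inf_eq_right.2 hKJ, K.2]
          ring
        · have hr := h.rank_inf_of_cover hJJ' hJ' hK.2 hKJ
          rw [K.2, Nat.add_right_cancel_iff] at hr
          rw [if_neg (fun h => hKJ h.2), hr]
          ring
      · rw [if_neg hK, if_neg (fun h => hK ⟨h.1, h.2.trans hJJ'⟩), mul_zero, mul_zero, sub_zero,
          Nat.cast_eq_zero, Set.ncard_eq_zero]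
        ext T
        simp only [Set.mem_ofPred_eq, Set.mem_empty_iff_false, iff_false]
        exact fun hT => hK ⟨hT.1.1.trans hT.2.1, hT.2.2⟩
    rw [← Submodule.smul_mem_iff _ hne, ← key]
    refine Submodule.sub_mem _ (Submodule.sum_mem _ fun T hT => ?_) (Submodule.smul_mem _ _ ?_)
    · obtain ⟨-, hT1, hT2, hT3⟩ := Finset.mem_filter.1 hT
      have := ih (I := T) (J := J') (hT2.trans hJJ') (by omega) (by omega)
      rwa [hT3, add_right_comm, add_assoc] at this
    · exact h.rowSpace_mono (by omega) hk (ih (hIJ.trans hJJ') (by omega) (by omega))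

/-- The indicator of a single `K` is both the pencil of `K` and the basic set of `⊥, K`; these lie
in the row spaces of ranks `k` and, when `n - k ≤ k`, `n - k`. -/
theorem rowSpace_min_eq_top (h : IsRankFunction rk) (hk : k ≤ rk (⊤ : L)) :
    rowSpace rk (min k (rk (⊤ : L) - k)) k = ⊤ := by
  classical
  have := Fintype.ofFinite (Sub rk k)
  suffices hs : ∀ K : Sub rk k, Pi.single K (1 : ℝ) ∈ rowSpace rk (min k (rk (⊤ : L) - k)) k by
    rw [eq_top_iff]
    intro f _
    rw [← Finset.univ_sum_single f]
    refine Submodule.sum_mem _ fun K _ => ?_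
    have : Pi.single K (f K) = f K • Pi.single K (1 : ℝ) := by
      rw [← Pi.single_smul, smul_eq_mul, mul_one]
    rw [this]
    exact Submodule.smul_mem _ _ (hs K)
  have heq : ∀ {K K' : Sub rk k}, K.1 ≤ K'.1 → K = K' := fun {K K'} hle => by
    rcases hle.eq_or_lt with he | hlt
    · exact Subtype.ext he
    · have := h.strictMono hlt
      rw [K.2, K'.2] at this
      omega
  intro K
  rcases le_total k (rk (⊤ : L) - k) with hle | hle
  · rw [min_eq_left hle]
    convert pencil_mem_rowSpace (k := k) K.2 using 1
    ext K'
    rw [pencil_apply, Pi.single_apply]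
    exact if_congr ⟨fun he => he ▸ le_rfl, fun hl => (heq hl).symm⟩ rfl rfl
  · rw [min_eq_right hle]
    have := h.charFun_basicSet_mem_rowSpace (k := k) (bot_le : ⊥ ≤ K.1) (j := rk (⊤ : L) - k)
      (by rw [K.2]; omega) (by rw [h.bot]; omega)
    rw [h.bot, zero_add] at this
    convert this using 1
    ext K'
    rw [charFun_basicSet_apply, Pi.single_apply]
    exact if_congr ⟨fun he => he ▸ ⟨bot_le, le_rfl⟩, fun hl => heq hl.2⟩ rfl rfl

end IsRankFunction

/-- A family of functionals certifying lower bounds for the degrees of basic sets. -/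
def HasDegreeWitnesses (rk : L → ℕ) (k : ℕ) : Prop :=
  ∀ I J : L, I ≤ J → rk I ≤ k → k ≤ rk J → ∃ φ : (Sub rk k → ℝ) →ₗ[ℝ] ℝ,
    (∀ T, rk T < min (rk I + cork rk J) (min k (rk (⊤ : L) - k)) → φ (pencil rk k T) = 0) ∧
      φ (charFun (basicSet rk k I J)) ≠ 0

theorem IsRankFunction.degSet_basicSet (h : IsRankFunction rk) (hk : k ≤ rk (⊤ : L))
    (hw : HasDegreeWitnesses rk k) {I J : L} (hIJ : I ≤ J) :
    degSet rk (basicSet rk k I J) =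
      if rk I > k ∨ cork rk J > rk (⊤ : L) - k then (⊥ : WithBot ℕ∞)
      else (((min (rk I + cork rk J) (min k (rk (⊤ : L) - k)) : ℕ) : ℕ∞) : WithBot ℕ∞) := by
  have hJ : rk J ≤ rk (⊤ : L) := h.strictMono.monotone le_top
  have hco : cork rk J = rk (⊤ : L) - rk J := rfl
  split_ifs with hc
  · rw [degSet, deg, if_pos]
    have : basicSet rk k I J = ∅ := by
      ext K
      simp only [basicSet, Set.mem_ofPred_eq, Set.mem_empty_iff_false, iff_false]
      rintro ⟨h1, h2⟩
      have h1 := h.strictMono.monotone h1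
      have h2 := h.strictMono.monotone h2
      rw [K.2] at h1 h2
      omega
    rw [this, charFun, Set.indicator_empty]
    rfl
  · obtain ⟨φ, hφ, hne⟩ := hw I J hIJ (by omega) (by omega)
    refine deg_eq_of_mem (fun h0 => hne (by rw [h0, map_zero])) (min_le_right _ _) ?_ fun s hs hf => ?_
    · rcases le_total (rk I + cork rk J) (min k (rk (⊤ : L) - k)) with hle | hle
      · rw [min_eq_left hle]
        exact h.charFun_basicSet_mem_rowSpace hIJ (by omega) (hle.trans (min_le_left _ _))
      · rw [min_eq_right hle, h.rowSpace_min_eq_top hk]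
        trivial
    · have : rowSpace rk s k ≤ LinearMap.ker φ := by
        rw [rowSpace_le_iff]
        rintro T rfl
        exact hφ T hs
      exact hne (this hf)

theorem IsRankFunction.deg_all (h : IsRankFunction rk) {n : ℕ} (hn : rk (⊤ : L) = n) (hk : k ≤ n)
    (hw : HasDegreeWitnesses rk k) :
    (∀ I J : L, I ≤ J → ∀ i j : ℕ, rk I = i → cork rk J = j →
        degSet rk (basicSet rk k I J) =
          if i > k ∨ j > n - k then (⊥ : WithBot ℕ∞)
          else (((min (i + j) (min k (n - k)) : ℕ) : ℕ∞) : WithBot ℕ∞)) ∧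
      (∀ (I : L) (i : ℕ), rk I = i →
        deg rk (pencil rk k I) =
          if i > k then (⊥ : WithBot ℕ∞) else (((min i (n - k) : ℕ) : ℕ∞) : WithBot ℕ∞)) ∧
      (∀ (J : L) (j : ℕ), cork rk J = j →
        deg rk (dualPencil rk k J) =
          if j > n - k then (⊥ : WithBot ℕ∞) else (((min j k : ℕ) : ℕ∞) : WithBot ℕ∞)) := by
  subst hn
  refine ⟨?_, ?_, ?_⟩
  · rintro I J hIJ _ _ rfl rfl
    exact h.degSet_basicSet hk hw hIJ
  · rintro I _ rfl
    have := h.degSet_basicSet hk hw (le_top : I ≤ ⊤)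
    have hc : cork rk (⊤ : L) = 0 := Nat.sub_self _
    rw [degSet, ← pencil_eq, hc] at this
    rw [this]
    refine if_ctx_congr (by simp) (fun _ => rfl) fun hi => ?_
    rw [show min (rk I + 0) (min k (rk (⊤ : L) - k)) = min (rk I) (rk (⊤ : L) - k) by omega]
  · rintro J _ rfl
    have := h.degSet_basicSet hk hw (bot_le : ⊥ ≤ J)
    rw [degSet, ← dualPencil_eq, h.bot] at this
    rw [this]
    refine if_ctx_congr (by simp) (fun _ => rfl) fun hj => ?_
    rw [show min (0 + cork rk J) (min k (rk (⊤ : L) - k)) = min (cork rk J) k by omega]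

end Lattice

/-! ### Witnesses for subsets of a finite set. -/

section SetCase

variable {V : Type*}

/-- Enumerate `U` with the elements of `S` first and keep the first `t` entries. -/
theorem _root_.Finset.exists_injective_fin_of_subset {S U : Finset V} (hSU : S ⊆ U) {t : ℕ}
    (ht : t ≤ U.card) : ∃ f : Fin t → V, Function.Injective f ∧ (∀ r, f r ∈ U) ∧
      ∀ r : Fin t, r.1 < S.card → f r ∈ S := by
  classical
  have hlen : (S.toList ++ (U \ S).toList).length = U.card := by
    rw [List.length_append, Finset.length_toList, Finset.length_toList, add_comm,
      Finset.card_sdiff_add_card_eq_card hSU]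
  have hnodup : (S.toList ++ (U \ S).toList).Nodup := by
    refine List.Nodup.append S.nodup_toList (U \ S).nodup_toList ?_
    intro x hx hx'
    rw [Finset.mem_toList] at hx hx'
    exact (Finset.mem_sdiff.1 hx').2 hx
  refine ⟨fun r => (S.toList ++ (U \ S).toList)[r.1]'(by omega), fun r s hrs => ?_, fun r => ?_,
    fun r hr => ?_⟩
  · exact Fin.ext ((hnodup.getElem_inj_iff).1 hrs)
  · have := List.getElem_mem (l := S.toList ++ (U \ S).toList) (n := r.1) (by omega)
    rw [List.mem_append, Finset.mem_toList, Finset.mem_toList, Finset.mem_sdiff] at this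
    exact this.elim (fun h => hSU h) And.left
  · simp only
    rw [List.getElem_append_left (by simpa using hr), ← Finset.mem_toList]
    exact List.getElem_mem _

variable [Fintype V] [DecidableEq V]

theorem isRankFunction_setRk : IsRankFunction (setRk V) where
  bot := Finset.card_empty
  strictMono _ _ h := Finset.card_lt_card h
  modular a b := Finset.card_union_add_card_inter a b
  covers := by
    refine ⟨fun i u => u - i, fun i u h => by simp only; omega, fun I U hIU => ?_⟩
    have : {T | I ≤ T ∧ T ≤ U ∧ setRk V T = setRk V I + 1}
        = (((U \ I).image fun a => insert a I : Finset (Finset V)) : Set (Finset V)) := by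
      ext T
      simp only [Set.mem_ofPred_eq, Finset.coe_image, Set.mem_image, SetLike.mem_coe,
        Finset.mem_sdiff, setRk]
      constructor
      · rintro ⟨h1, h2, h3⟩
        obtain ⟨a, ha, rfl⟩ := Finset.exists_eq_insert_iff.2 ⟨h1, h3.symm⟩
        exact ⟨a, ⟨h2 (Finset.mem_insert_self a I), ha⟩, rfl⟩
      · rintro ⟨a, ⟨ha, ha'⟩, rfl⟩
        exact ⟨Finset.subset_insert a I, Finset.insert_subset ha hIU,
          Finset.card_insert_of_notMem ha'⟩
    rw [this, Set.ncard_coe_finset, Finset.card_image_of_injOn, Finset.card_sdiff_of_subset hIU]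
    · rfl
    · intro a ha b hb hab
      rw [SetLike.mem_coe, Finset.mem_sdiff] at ha
      have : a ∈ insert b I := (show insert a I = insert b I from hab) ▸ Finset.mem_insert_self a I
      exact (Finset.mem_insert.1 this).resolve_right ha.2

/-- The set obtained from `K` by replacing `a r` with `b r` for all `r ∈ S`. -/
def exchange {t : ℕ} (K : Finset V) (a b : Fin t → V) (S : Finset (Fin t)) : Finset V :=
  (K \ S.image a) ∪ S.image b

omit [Fintype V] in
theorem mem_exchange {t : ℕ} {K : Finset V} {a b : Fin t → V} {S : Finset (Fin t)} {x : V} :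
    x ∈ exchange K a b S ↔ (x ∈ K ∧ ∀ r ∈ S, a r ≠ x) ∨ ∃ r ∈ S, b r = x := by
  simp [exchange]

omit [Fintype V] in
theorem subset_exchange_insert_iff {t : ℕ} {K T : Finset V} {a b : Fin t → V} {S : Finset (Fin t)}
    {r : Fin t} (ha : a r ∉ T) (hb : b r ∉ T) :
    T ⊆ exchange K a b (insert r S) ↔ T ⊆ exchange K a b S := by
  refine forall₂_congr fun x hx => ?_
  have h1 : a r ≠ x := fun h => ha (h ▸ hx)
  have h2 : b r ≠ x := fun h => hb (h ▸ hx)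
  simp [mem_exchange, h1, h2]

section exchange

variable {t : ℕ} {K : Finset V} {a b : Fin t → V} (ha : Function.Injective a)
  (hb : Function.Injective b) (haK : ∀ r, a r ∈ K) (hbK : ∀ r, b r ∉ K)

include ha hb haK hbK

omit [Fintype V] in
theorem card_exchange (S : Finset (Fin t)) : (exchange K a b S).card = K.card := by
  have hsub : S.image a ⊆ K := Finset.image_subset_iff.2 fun r _ => haK r
  have h := Finset.card_le_card hsub
  rw [exchange, Finset.card_union_of_disjoint, Finset.card_sdiff_of_subset hsub,
    Finset.card_image_of_injective _ hb]
  · rw [Finset.card_image_of_injective _ ha] at h ⊢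
    omega
  · rw [Finset.disjoint_left]
    intro x hx hx'
    obtain ⟨r, -, rfl⟩ := Finset.mem_image.1 hx'
    exact hbK r (Finset.mem_sdiff.1 hx).1

end exchange

-- Pigeonhole: the pairs are disjoint, so if `T` met all of them, choosing an element of `T` from
-- each would inject `Fin t` into `T`.
omit [Fintype V] in
theorem exists_pair_notMem {t : ℕ} {K T : Finset V} {a b : Fin t → V}
    (ha : Function.Injective a) (hb : Function.Injective b) (haK : ∀ r, a r ∈ K)
    (hbK : ∀ r, b r ∉ K) (hT : T.card < t) : ∃ r, a r ∉ T ∧ b r ∉ T := by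
  by_contra! hcon
  have hinj : Function.Injective fun r => if a r ∈ T then a r else b r := by
    intro r s hrs
    simp only at hrs
    split_ifs at hrs with h1 h2 h2
    · exact ha hrs
    · exact absurd (hrs ▸ haK r) (hbK s)
    · exact absurd (hrs ▸ haK s) (hbK r)
    · exact hb hrs
  have := Finset.card_le_card_of_injOn (s := Finset.univ) (t := T) _ (fun r _ => by
    split_ifs with h
    · exact h
    · exact hcon r h) hinj.injOn
  rw [Finset.card_univ, Fintype.card_fin] at this
  omega

theorem hasDegreeWitnesses_setRk (k : ℕ) : HasDegreeWitnesses (setRk V) k := by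
  intro I J hIJ hI hJ
  obtain ⟨K, hIK, hKJ, hK⟩ := isRankFunction_setRk.exists_between hIJ hI hJ
  set t := min (setRk V I + cork (setRk V) J) (min k (setRk V ⊤ - k)) with ht
  have hcK : Kᶜ.card = setRk V ⊤ - k := by
    rw [Finset.card_compl, ← hK]
    rfl
  have hcJ : Jᶜ.card = cork (setRk V) J := by
    rw [Finset.card_compl]
    rfl
  obtain ⟨a, ha, haK, haI⟩ := Finset.exists_injective_fin_of_subset hIK (t := t)
    (by change t ≤ setRk V K; omega)
  obtain ⟨b', hb', hbK', hbJ'⟩ := Finset.exists_injective_fin_of_subset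
    (Finset.compl_subset_compl.2 hKJ) (t := t) (by omega)
  -- Elements of `I` come first in `a`, and the reversal puts elements outside `J` last in `b`.
  -- Since `t ≤ i + j`, each pair has `a r ∈ I` or `b r ∉ J`.
  let b : Fin t → V := fun r => b' r.rev
  have hb : Function.Injective b := hb'.comp Fin.rev_injective
  have hbK : ∀ r, b r ∉ K := fun r => Finset.mem_compl.1 (hbK' _)
  have hpair : ∀ r, a r ∈ I ∨ b r ∉ J := fun r => by
    by_cases hr : r.1 < I.card
    · exact Or.inl (haI r hr)
    · refine Or.inr (Finset.mem_compl.1 (hbJ' _ ?_))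
      rw [Fin.val_rev, hcJ]
      change ¬ r.1 < setRk V I at hr
      have := r.2
      omega
  let E : Finset (Fin t) → Sub (setRk V) k := fun S =>
    ⟨exchange K a b S, (card_exchange ha hb haK hbK S).trans hK⟩
  refine ⟨∑ S, (-1 : ℝ) ^ S.card • LinearMap.proj (E S), fun T hT => ?_, ?_⟩
  · obtain ⟨r, har, hbr⟩ := exists_pair_notMem ha hb haK hbK hT
    rw [LinearMap.sum_apply]
    -- Toggling a pair missed by `T` flips the sign but not whether `T` is contained in the
    -- exchanged set.
    refine Finset.sum_involution (fun S _ => if r ∈ S then S.erase r else insert r S) ?_ ?_ ?_ ?_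
    · intro S _
      have key : ∀ S, r ∉ S → ((-1 : ℝ) ^ S.card • LinearMap.proj (R := ℝ) (E S)) (pencil (setRk V) k T)
          + ((-1 : ℝ) ^ (insert r S).card • LinearMap.proj (R := ℝ) (E (insert r S)))
            (pencil (setRk V) k T) = 0 := by
        intro S hr
        have : pencil (setRk V) k T (E (insert r S)) = pencil (setRk V) k T (E S) := by
          rw [pencil_apply, pencil_apply]
          congr 1
          exact propext (subset_exchange_insert_iff har hbr)
        rw [LinearMap.smul_apply, LinearMap.smul_apply, LinearMap.proj_apply, LinearMap.proj_apply,
          this, Finset.card_insert_of_notMem hr]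
        simp only [smul_eq_mul]
        ring
      split_ifs with hr
      · have := key (S.erase r) (Finset.notMem_erase r S)
        rw [Finset.insert_erase hr, add_comm] at this
        exact this
      · exact key S hr
    · intro S _ _
      split_ifs with hr
      · exact (Finset.erase_ssubset hr).ne
      · exact fun h => hr (h ▸ Finset.mem_insert_self r S)
    · exact fun _ _ => Finset.mem_univ _
    · intro S _
      by_cases hr : r ∈ S
      · simp [hr]
      · simp [hr]
  · rw [LinearMap.sum_apply, Finset.sum_eq_single_of_mem ∅ (Finset.mem_univ _)]
    · rw [LinearMap.smul_apply, LinearMap.proj_apply, charFun_basicSet_apply, if_pos]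
      · simp
      · simpa [E, exchange] using ⟨hIK, hKJ⟩
    -- Any exchange leaves the basic set, by losing an element of `I` or gaining one outside `J`.
    · intro S _ hS
      obtain ⟨r, hr⟩ := Finset.nonempty_iff_ne_empty.2 hS
      rw [LinearMap.smul_apply, LinearMap.proj_apply, charFun_basicSet_apply, if_neg, smul_zero]
      rintro ⟨h1, h2⟩
      rcases hpair r with h | h
      · rcases mem_exchange.1 (h1 h) with h3 | ⟨s, -, hs⟩
        · exact h3.2 r hr rfl
        · exact hbK s (hs ▸ haK r)
      · exact h (h2 (mem_exchange.2 (Or.inr ⟨r, hr, rfl⟩)))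

end SetCase

/-! ### Witnesses for subspaces over a finite field. -/

section VectorSpaceCase

open Module LinearMap

section RankConstruction

variable {F E E' : Type*} [Field F] [AddCommGroup E] [Module F E] [FiniteDimensional F E]
  [AddCommGroup E'] [Module F E'] [FiniteDimensional F E']

theorem exists_linearMap_finrank_range_eq {r : ℕ} (h : r ≤ finrank F E) (h' : r ≤ finrank F E') :
    ∃ f : E →ₗ[F] E', finrank F (range f) = r := by
  obtain ⟨g, hg⟩ := finrank_le_iff_exists_linearMap.1 ((finrank_fin_fun F (n := r)).trans_le h)
  obtain ⟨g', hg'⟩ := finrank_le_iff_exists_linearMap.1 ((finrank_fin_fun F (n := r)).trans_le h')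
  obtain ⟨p, hp⟩ := g.exists_leftInverse_of_injective (ker_eq_bot.2 hg)
  refine ⟨g' ∘ₗ p, ?_⟩
  have hsurj : range p = ⊤ := range_eq_top.2 fun x => ⟨g x, LinearMap.congr_fun hp x⟩
  rw [range_comp_of_range_eq_top _ hsurj, finrank_range_of_inj hg', finrank_fin_fun]

/-- A complement `E₂` of `E₁` may be mapped freely and supplies rank up to `dim E₂`; only the excess
`t - dim E₂`, truncated at zero, must come from `E₁` mapping into `S`. Sending `E₂` into a
complement of the first image makes the ranks add. -/
theorem exists_linearMap_map_le_finrank_range (E₁ : Submodule F E) (S : Submodule F E') {t : ℕ}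
    (hE : t ≤ finrank F E) (hE' : t ≤ finrank F E')
    (hS : t + finrank F E₁ ≤ finrank F S + finrank F E) :
    ∃ B : E →ₗ[F] E', (∀ y ∈ E₁, B y ∈ S) ∧ finrank F (range B) = t := by
  obtain ⟨E₂, hc⟩ := E₁.exists_isCompl
  have hdim := Submodule.finrank_add_eq_of_isCompl hc
  obtain ⟨f₁, hf₁⟩ := exists_linearMap_finrank_range_eq (F := F) (E := E₁) (E' := S)
    (r := t - finrank F E₂) (by omega) (by omega)
  have hr₁ : finrank F (range (S.subtype ∘ₗ f₁)) = t - finrank F E₂ := by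
    rw [range_comp, Submodule.finrank_map_subtype_eq, hf₁]
  obtain ⟨R, hR⟩ := (range (S.subtype ∘ₗ f₁)).exists_isCompl
  have hdim' := Submodule.finrank_add_eq_of_isCompl hR
  obtain ⟨f₂, hf₂⟩ := exists_linearMap_finrank_range_eq (F := F) (E := E₂) (E' := R)
    (r := t - (t - finrank F E₂)) (by omega) (by omega)
  have hr₂ : finrank F (range (R.subtype ∘ₗ f₂)) = t - (t - finrank F E₂) := by
    rw [range_comp, Submodule.finrank_map_subtype_eq, hf₂]
  refine ⟨ofIsCompl hc (S.subtype ∘ₗ f₁) (R.subtype ∘ₗ f₂), fun y hy => ?_, ?_⟩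
  · rw [show y = ((⟨y, hy⟩ : E₁) : E) from rfl, ofIsCompl_apply_left]
    exact (f₁ _).2
  · have hle : range (R.subtype ∘ₗ f₂) ≤ R := by
      rintro _ ⟨x, rfl⟩
      exact (f₂ x).2
    have := Submodule.finrank_sup_add_finrank_inf_eq (range (S.subtype ∘ₗ f₁))
      (range (R.subtype ∘ₗ f₂))
    rw [(hR.disjoint.mono_right hle).eq_bot, finrank_bot, hr₁, hr₂] at this
    rw [range_ofIsCompl]
    omega

end RankConstruction

variable {F V : Type*} [Field F] [AddCommGroup V] [Module F V]

/-- The graph of a linear map between two subspaces of `V`, as a subspace of `V`. -/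
def graphSubmodule {K C : Submodule F V} (A : K →ₗ[F] C) : Submodule F V :=
  range (K.subtype + C.subtype ∘ₗ A)

section Graph

variable {K C : Submodule F V}

theorem mem_graphSubmodule_iff (h : IsCompl K C) (A : K →ₗ[F] C) (v : V) :
    v ∈ graphSubmodule A ↔ A (K.projectionOnto C h v) = C.projectionOnto K h.symm v := by
  constructor
  · rintro ⟨x, rfl⟩
    simp
  · intro hv
    refine ⟨K.projectionOnto C h v, ?_⟩
    rw [LinearMap.add_apply, LinearMap.comp_apply, hv]
    exact Submodule.projection_add_projection_eq_self h v

theorem finrank_graphSubmodule (h : IsCompl K C) (A : K →ₗ[F] C) :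
    finrank F (graphSubmodule A) = finrank F K := by
  refine finrank_range_of_inj fun x y hxy => ?_
  have := congrArg (K.projectionOnto C h) hxy
  simpa using this

theorem graphSubmodule_zero : graphSubmodule (0 : K →ₗ[F] C) = K := by
  simp [graphSubmodule]

theorem le_graphSubmodule_iff_of_le (h : IsCompl K C) {I : Submodule F V} (hI : I ≤ K)
    (A : K →ₗ[F] C) : I ≤ graphSubmodule A ↔ ∀ x : K, (x : V) ∈ I → A x = 0 := by
  constructor
  · intro hA x hx
    have := (mem_graphSubmodule_iff h A x).1 (hA hx)
    simpa using this
  · intro hA v hv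
    rw [mem_graphSubmodule_iff h, Submodule.projectionOnto_apply_of_mem_left h (hI hv),
      Submodule.projectionOnto_apply_of_mem_right h.symm (hI hv)]
    exact hA ⟨v, hI hv⟩ hv

theorem graphSubmodule_le_iff_of_le {J : Submodule F V} (hJ : K ≤ J) (A : K →ₗ[F] C) :
    graphSubmodule A ≤ J ↔ ∀ x, (A x : V) ∈ J := by
  constructor
  · intro hA x
    have : (x : V) + A x ∈ J := hA ⟨x, rfl⟩
    exact (J.add_mem_iff_right (hJ x.2)).1 this
  · rintro hA _ ⟨x, rfl⟩
    exact J.add_mem (hJ x.2) (hA x)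

/-- Here `A` maps into `J` and vanishes on `I`, while `B` maps `C ⊓ J` into `I`. So `A ∘ B ∘ A = 0`
and `B ∘ₗ A` is nilpotent. -/
theorem trace_comp_eq_zero (h : IsCompl K C) {I J : Submodule F V} (hI : I ≤ K) (hJ : K ≤ J)
    {B : C →ₗ[F] K} (hB : ∀ y : C, (y : V) ∈ J → (B y : V) ∈ I) {A : K →ₗ[F] C}
    (hIA : I ≤ graphSubmodule A) (hAJ : graphSubmodule A ≤ J) : trace F K (B ∘ₗ A) = 0 := by
  refine (isNilpotent_trace_of_isNilpotent ⟨2, ?_⟩).eq_zero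
  rw [le_graphSubmodule_iff_of_le h hI] at hIA
  rw [graphSubmodule_le_iff_of_le hJ] at hAJ
  ext x
  rw [pow_two, Module.End.mul_apply, LinearMap.comp_apply, LinearMap.comp_apply,
    hIA _ (hB _ (hAJ x)), map_zero]
  rfl

variable [FiniteDimensional F V]

-- The projection of `T` to `K` is too small to contain the range of `B`, so some `φ` vanishes on it
-- with `φ (B y) ≠ 0`. Adding multiples of the rank-one map `A₀ = φ ⊗ y` preserves `T ≤
-- graphSubmodule A`, while the trace runs once through `F`; averaging gives `∑ c, g c = 0`.
open Classical in
theorem sum_trace_comp_mul_le_graphSubmodule_eq_zero [Fintype F] [Fintype (K →ₗ[F] C)]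
    (h : IsCompl K C) {g : F → ℝ} (hg : ∑ c, g c = 0) (B : C →ₗ[F] K) {T : Submodule F V}
    (hT : finrank F T < finrank F (range B)) :
    ∑ A : K →ₗ[F] C, g (trace F K (B ∘ₗ A)) * (if T ≤ graphSubmodule A then 1 else 0) = 0 := by
  obtain ⟨y, hy⟩ : ∃ y, B y ∉ T.map (K.projectionOnto C h) := by
    by_contra! hcon
    have h1 : range B ≤ T.map (K.projectionOnto C h) := by
      rintro _ ⟨y, rfl⟩
      exact hcon y
    have := (Submodule.finrank_mono h1).trans (Submodule.finrank_map_le _ T)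
    omega
  obtain ⟨φ, hφ, hker⟩ := Submodule.exists_le_ker_of_notMem hy
  let A₀ : K →ₗ[F] C := φ.smulRight y
  have htr : ∀ (A : K →ₗ[F] C) (c : F),
      trace F K (B ∘ₗ (A + c • A₀)) = trace F K (B ∘ₗ A) + c * φ (B y) := by
    intro A c
    have : B ∘ₗ A₀ = φ.smulRight (B y) := by
      ext x
      simp [A₀]
    rw [LinearMap.comp_add, LinearMap.comp_smul, map_add, map_smul, this, trace_smulRight,
      smul_eq_mul]
  have hle : ∀ (A : K →ₗ[F] C) (c : F),
      T ≤ graphSubmodule (A + c • A₀) ↔ T ≤ graphSubmodule A := by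
    intro A c
    refine forall₂_congr fun v hv => ?_
    have : φ (K.projectionOnto C h v) = 0 := hker (Submodule.mem_map_of_mem hv)
    simp only [mem_graphSubmodule_iff h, LinearMap.add_apply, LinearMap.smul_apply, A₀,
      LinearMap.smulRight_apply, this, zero_smul, smul_zero, add_zero]
  set f : (K →ₗ[F] C) → ℝ :=
    fun A => g (trace F K (B ∘ₗ A)) * (if T ≤ graphSubmodule A then 1 else 0) with hf
  have h1 : ∑ c : F, ∑ A, f (A + c • A₀) = Fintype.card F * ∑ A, f A := by
    have hshift : ∀ c : F, ∑ A, f (A + c • A₀) = ∑ A, f A :=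
      fun c => Equiv.sum_comp (Equiv.addRight (c • A₀)) f
    rw [Finset.sum_congr rfl fun c _ => hshift c, Finset.sum_const, nsmul_eq_mul, Finset.card_univ]
  have h2 : ∑ c : F, ∑ A, f (A + c • A₀) = 0 := by
    rw [Finset.sum_comm]
    refine Finset.sum_eq_zero fun A _ => ?_
    simp only [hf, htr, hle]
    have hshift : ∑ c, g (trace F K (B ∘ₗ A) + c * φ (B y)) = ∑ c, g c :=
      Equiv.sum_comp ((Equiv.mulRight₀ _ hφ).trans (Equiv.addLeft (trace F K (B ∘ₗ A)))) g
    rw [← Finset.sum_mul, hshift, hg, zero_mul]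
  rw [h2] at h1
  exact (mul_eq_zero.1 h1.symm).resolve_left (by exact_mod_cast Fintype.card_ne_zero)

end Graph

/-! ### Counting covers, and the witness functional. -/

variable [Finite F] [FiniteDimensional F V]

theorem ncard_mem_notMem_add {I T : Submodule F V} (h : I ≤ T) :
    {v | v ∈ T ∧ v ∉ I}.ncard + Nat.card F ^ finrank F I = Nat.card F ^ finrank F T := by
  have : Finite V := Module.finite_of_finite F
  rw [← Module.natCard_eq_pow_finrank, ← Module.natCard_eq_pow_finrank]
  exact Set.ncard_sdiff_add_ncard_of_subset (s := (I : Set V)) (t := T) h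

/-- Each vector of `U` outside `I` spans, together with `I`, exactly one cover `T`, and every `T`
arises from the same number of vectors. -/
theorem ncard_covers_mul [Finite (Submodule F V)] {I U : Submodule F V} (h : I ≤ U) :
    {T | I ≤ T ∧ T ≤ U ∧ finrank F T = finrank F I + 1}.ncard *
        (Nat.card F ^ (finrank F I + 1) - Nat.card F ^ finrank F I) + Nat.card F ^ finrank F I =
      Nat.card F ^ finrank F U := by
  classical
  have : Finite V := Module.finite_of_finite F
  have := Fintype.ofFinite V
  have := Fintype.ofFinite (Submodule F V)
  rw [← ncard_mem_notMem_add h]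
  congr 1
  have hmaps : ∀ v ∈ Finset.univ.filter (fun v => v ∈ U ∧ v ∉ I), I ⊔ Submodule.span F {v} ∈
      Finset.univ.filter (fun T => I ≤ T ∧ T ≤ U ∧ finrank F T = finrank F I + 1) := by
    intro v hv
    obtain ⟨-, hvU, hvI⟩ := Finset.mem_filter.1 hv
    refine Finset.mem_filter.2 ⟨Finset.mem_univ _, le_sup_left, sup_le h ?_,
      Submodule.finrank_sup_span_singleton hvI⟩
    rwa [Submodule.span_singleton_le_iff_mem]
  have hcard := Finset.card_eq_sum_card_fiberwise hmaps
  rw [Finset.sum_congr rfl (g := fun _ =>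
    Nat.card F ^ (finrank F I + 1) - Nat.card F ^ finrank F I), Finset.sum_const, smul_eq_mul,
    ← Set.ncard_coe_finset, ← Set.ncard_coe_finset] at hcard
  · simpa using hcard.symm
  · intro T hT
    obtain ⟨-, hIT, hTU, hr⟩ := Finset.mem_filter.1 hT
    rw [← hr, ← ncard_mem_notMem_add hIT, Nat.add_sub_cancel, ← Set.ncard_coe_finset]
    congr 1
    ext v
    simp only [Finset.coe_filter, Finset.mem_filter, Finset.mem_univ, true_and, Set.mem_ofPred_eq]
    constructor
    · rintro ⟨⟨-, hvI⟩, rfl⟩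
      exact ⟨Submodule.mem_sup_right (Submodule.mem_span_singleton_self v), hvI⟩
    · rintro ⟨hvT, hvI⟩
      refine ⟨⟨hTU hvT, hvI⟩, Submodule.eq_of_le_of_finrank_eq (sup_le hIT ?_) ?_⟩
      · rwa [Submodule.span_singleton_le_iff_mem]
      · rw [Submodule.finrank_sup_span_singleton hvI, hr]

theorem isRankFunction_linRk [Finite (Submodule F V)] : IsRankFunction (linRk F V) where
  bot := finrank_bot F V
  strictMono _ _ h := Submodule.finrank_lt_finrank_of_lt h
  modular a b := Submodule.finrank_sup_add_finrank_inf_eq a b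
  covers := by
    refine ⟨fun i u => ∑ m ∈ Finset.range (u - i), Nat.card F ^ m, fun i u h => ?_,
      fun I U hIU => ?_⟩
    · simp only
      rw [Nat.sub_add_comm h, Finset.sum_range_succ]
      exact Nat.lt_add_of_pos_right (pow_pos Nat.card_pos _)
    · have hq : 1 < Nat.card F := Finite.one_lt_card
      have hmono := Submodule.finrank_mono hIU
      have key := ncard_covers_mul hIU
      have hle : Nat.card F ^ finrank F I ≤ Nat.card F ^ (finrank F I + 1) :=
        Nat.pow_le_pow_right hq.le (Nat.le_succ _)
      have hgeom := geom_sum_mul (Nat.card F : ℤ) (finrank F U - finrank F I)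
      have hpow : (Nat.card F : ℤ) ^ finrank F U
          = (Nat.card F : ℤ) ^ finrank F I * (Nat.card F : ℤ) ^ (finrank F U - finrank F I) := by
        rw [← pow_add, Nat.add_sub_cancel' hmono]
      have hne : (Nat.card F : ℤ) ^ finrank F I * ((Nat.card F : ℤ) - 1) ≠ 0 :=
        mul_ne_zero (pow_ne_zero _ (by omega)) (by omega)
      unfold linRk
      generalize {T | I ≤ T ∧ T ≤ U ∧ finrank F T = finrank F I + 1}.ncard = N at key ⊢
      zify [hle] at key ⊢
      refine mul_right_cancel₀ hne ?_
      linear_combination key - (Nat.card F : ℤ) ^ finrank F I * hgeom + hpow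

theorem hasDegreeWitnesses_linRk [Finite (Submodule F V)] (k : ℕ) :
    HasDegreeWitnesses (linRk F V) k := by
  classical
  intro I J hIJ hI hJ
  obtain ⟨K, hIK, hKJ, hK⟩ := isRankFunction_linRk.exists_between hIJ hI hJ
  set t := min (linRk F V I + cork (linRk F V) J) (min k (linRk F V ⊤ - k)) with ht
  obtain ⟨C, hc⟩ := K.exists_isCompl
  have hfin : finrank F K + finrank F C = linRk F V ⊤ :=
    (Submodule.finrank_add_eq_of_isCompl hc).trans (finrank_top F V).symm
  have hsup : finrank F (J.comap C.subtype) + linRk F V ⊤ = linRk F V J + finrank F C := by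
    have h1 : J ⊔ C = ⊤ := top_le_iff.1 (hc.sup_eq_top ▸ sup_le_sup_right hKJ C)
    have h2 := Submodule.finrank_sup_add_finrank_inf_eq J C
    rw [h1] at h2
    have h3 : finrank F (J.comap C.subtype) = finrank F (J ⊓ C : Submodule F V) := by
      rw [← Submodule.finrank_map_subtype_eq, Submodule.map_comap_subtype, inf_comm]
    rw [h3, add_comm]
    exact h2
  have hIc : finrank F (I.comap K.subtype) = linRk F V I := by
    rw [← Submodule.finrank_map_subtype_eq, Submodule.map_comap_subtype, inf_eq_right.2 hIK]
    rfl
  have hJtop : linRk F V J ≤ linRk F V ⊤ := isRankFunction_linRk.strictMono.monotone le_top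
  have hco : cork (linRk F V) J = linRk F V ⊤ - linRk F V J := rfl
  change finrank F K = k at hK
  -- As `C ⊓ J` has codimension `j` in `C`, the rank condition amounts to `t ≤ i + j`.
  obtain ⟨B, hB, hBt⟩ := exists_linearMap_map_le_finrank_range (J.comap C.subtype)
    (I.comap K.subtype) (t := t) (by omega) (by omega) (by omega)
  have : Finite V := Module.finite_of_finite F
  have : Finite (K →ₗ[F] C) := Finite.of_injective _ DFunLike.coe_injective
  have := Fintype.ofFinite (K →ₗ[F] C)
  have := Fintype.ofFinite F
  -- Total zero kills the small pencils. Every graph in the basic set has trace zero, hence positive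
  -- weight `q - 1`, and `A = 0` gives `K` itself.
  let g : F → ℝ := fun c => (if c = 0 then (Fintype.card F : ℝ) else 0) - 1
  have hg : ∑ c, g c = 0 := by simp [g]
  have hg0 : 0 < g 0 := by
    have : (1 : ℝ) < Fintype.card F := by exact_mod_cast Fintype.one_lt_card
    simpa [g] using this
  let Γ : (K →ₗ[F] C) → Sub (linRk F V) k := fun A =>
    ⟨graphSubmodule A, (finrank_graphSubmodule hc A).trans hK⟩
  refine ⟨∑ A, g (trace F K (B ∘ₗ A)) • LinearMap.proj (Γ A), fun T hT => ?_, ?_⟩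
  · rw [LinearMap.sum_apply]
    have := sum_trace_comp_mul_le_graphSubmodule_eq_zero hc hg B (T := T) (hBt ▸ hT)
    rw [← this]
    refine Finset.sum_congr rfl fun A _ => ?_
    rw [LinearMap.smul_apply, LinearMap.proj_apply, pencil_apply, smul_eq_mul]
  · rw [LinearMap.sum_apply]
    refine (Finset.sum_pos' (fun A _ => ?_) ⟨0, Finset.mem_univ _, ?_⟩).ne'
    · rw [LinearMap.smul_apply, LinearMap.proj_apply, charFun_basicSet_apply, smul_eq_mul]
      split_ifs with hA
      · rw [trace_comp_eq_zero hc hIK hKJ hB hA.1 hA.2, mul_one]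
        exact hg0.le
      · rw [mul_zero]
    · rw [LinearMap.smul_apply, LinearMap.proj_apply, charFun_basicSet_apply, if_pos]
      · simpa using hg0
      · change I ≤ graphSubmodule 0 ∧ graphSubmodule 0 ≤ J
        rw [graphSubmodule_zero]
        exact ⟨hIK, hKJ⟩

end VectorSpaceCase

end CameronLiebler

theorem theorem6p6 :
    -- the set case
    (∀ (V : Type*) [Fintype V] (n k : ℕ), Fintype.card V = n → k ≤ n →
      (∀ I J : Finset V, I ≤ J → ∀ i j : ℕ, setRk V I = i → cork (setRk V) J = j →
        degSet (setRk V) (basicSet (setRk V) k I J) =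
          if i > k ∨ j > n - k then (⊥ : WithBot ℕ∞)
          else (((min (i + j) (min k (n - k)) : ℕ) : ℕ∞) : WithBot ℕ∞)) ∧
      (∀ (I : Finset V) (i : ℕ), setRk V I = i →
        deg (setRk V) (pencil (setRk V) k I) =
          if i > k then (⊥ : WithBot ℕ∞) else (((min i (n - k) : ℕ) : ℕ∞) : WithBot ℕ∞)) ∧
      (∀ (J : Finset V) (j : ℕ), cork (setRk V) J = j →
        deg (setRk V) (dualPencil (setRk V) k J) =
          if j > n - k then (⊥ : WithBot ℕ∞) else (((min j k : ℕ) : ℕ∞) : WithBot ℕ∞))) ∧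
    -- the vector space case
    (∀ (F : Type*) [Field F] [Finite F] (V : Type*) [AddCommGroup V] [Module F V]
        [FiniteDimensional F V] (n k : ℕ), Module.finrank F V = n → k ≤ n →
      (∀ I J : Submodule F V, I ≤ J → ∀ i j : ℕ, linRk F V I = i → cork (linRk F V) J = j →
        degSet (linRk F V) (basicSet (linRk F V) k I J) =
          if i > k ∨ j > n - k then (⊥ : WithBot ℕ∞)
          else (((min (i + j) (min k (n - k)) : ℕ) : ℕ∞) : WithBot ℕ∞)) ∧
      (∀ (I : Submodule F V) (i : ℕ), linRk F V I = i →
        deg (linRk F V) (pencil (linRk F V) k I) =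
          if i > k then (⊥ : WithBot ℕ∞) else (((min i (n - k) : ℕ) : ℕ∞) : WithBot ℕ∞)) ∧
      (∀ (J : Submodule F V) (j : ℕ), cork (linRk F V) J = j →
        deg (linRk F V) (dualPencil (linRk F V) k J) =
          if j > n - k then (⊥ : WithBot ℕ∞) else (((min j k : ℕ) : ℕ∞) : WithBot ℕ∞))) := by
  refine ⟨fun V _ n k hn hk => ?_, fun F _ _ V _ _ _ n k hn hk => ?_⟩
  · classical
    exact isRankFunction_setRk.deg_all (hn ▸ Finset.card_univ) hk (hasDegreeWitnesses_setRk k)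
  · have : Finite V := Module.finite_of_finite F
    have : Finite (Submodule F V) := Finite.of_injective _ SetLike.coe_injective
    exact isRankFunction_linRk.deg_all (hn ▸ finrank_top F V) hk (hasDegreeWitnesses_linRk k)
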